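/- Let $X$ be a finite connected nonempty graph (loops and multiple edges allowed) with vertex set $V(X)$ and edge set $E(X)$, and let $g=|E(X)|-|V(X)|+1$ be its genus. A closed path is a nonempty sequence $P=e_1\cdots e_k$ of oriented edges such that the target of each $e_i$ is the source of the cyclically next one; it is reduced if no $e_i$ is followed, cyclically, by its reversal, and primitive if it is reduced and is not of the form $Q^c$ for a closed path $Q$ and an integer $c\ge 2$. A prime of $X$ is a class $[P]$ of primitive closed paths up to cyclic rotation. Let $x=(x_e)_{e\in E(X)}$ be complex numbers with positive real parts (for example, positive real edge lengths), and put $M(P)=x_{e_1}+\cdots+x_{e_k}$, where $x_{e_i}$ is taken at the underlying unoriented edge. The metric zeta function of $X$ is $$\zeta_M(s,x_e,X)=\prod_{[P]}\bigl(1-s^{M(P)}\bigr)^{-1},$$ the product being over all primes of $X$, with principal branches of the powers. The Jacobian polynomial of $X$ is $$J_X(x_e)=\sum_{T}\ \prod_{e\in E(X)\setminus E(T)}x_e,$$ the sum being over all spanning trees $T$ of $X$. Then for all $s\in\mathbb{C}\setminus(-\infty,0]$ of sufficiently small modulus (depending on $X$ and $x$) the product converges unconditionally to a nonzero value; its reciprocal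 $\zeta_M(s,x_e,X)^{-1}$ continues to a (necessarily unique) holomorphic function on $\mathbb{C}\setminus(-\infty,0]$; and this continuation satisfies, as $s\to 1$, $$\zeta_M(s,x_e,X)^{-1}=2^{g}(-1)^{g+1}(g-1)\,J_X(x_e)\,(s-1)^g+O\bigl((s-1)^{g+1}\bigr).$$ -/

import Mathlib

open Filter Topology Asymptotics

/-- A graph in the sense of Serre with vertex set `V` and set of half-edges `H`: a fixed-point-free
involution on the half-edges and a root map. Loops and multiple edges are allowed.
A half-edge `h` also stands for the oriented edge `(h, inv h)`; the oppositely oriented edge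
is then `inv h`. -/
structure SerreGraph (V : Type*) (H : Type*) where
  /-- the involution on half-edges, equivalently orientation reversal of oriented edges -/
  inv : H → H
  inv_inv : ∀ h, inv (inv h) = h
  inv_ne : ∀ h, inv h ≠ h
  /-- the root vertex of a half-edge -/
  root : H → V

namespace SerreGraph

variable {V H : Type*} (X : SerreGraph V H)

/-- The source of an oriented edge. -/
def source (h : H) : V := X.root h

/-- The target of an oriented edge. -/
def target (h : H) : V := X.root (X.inv h)

/-- Two half-edges are equivalent if they lie in the same orbit of the involution. -/
def edgeSetoid : Setoid H where
  r h k := k = h ∨ k = X.inv h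
  iseqv :=
    { refl := fun _ => Or.inl rfl
      symm := by
        rintro h k (rfl | rfl)
        · exact Or.inl rfl
        · exact Or.inr (X.inv_inv h).symm
      trans := by
        rintro h k l (rfl | rfl) (rfl | rfl)
        · exact Or.inl rfl
        · exact Or.inr rfl
        · exact Or.inr rfl
        · exact Or.inl (X.inv_inv h) }

/-- The (unoriented) edges: orbits of the involution. -/
def Edge : Type _ := Quotient X.edgeSetoid

/-- The edge underlying an oriented edge. -/
def edge (h : H) : X.Edge := Quotient.mk X.edgeSetoid h

noncomputable instance [Finite H] : Fintype X.Edge :=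
  haveI : Finite X.Edge := Quotient.finite X.edgeSetoid
  Fintype.ofFinite X.Edge

noncomputable instance : DecidableEq X.Edge := Classical.decEq X.Edge

/-- The spanning subgraph with all vertices of `X` and with edge set `T` is connected
(and nonempty). -/
def ConnectedBy (T : Set X.Edge) : Prop :=
  Nonempty V ∧ ∀ u v : V, Relation.ReflTransGen
    (fun a b => ∃ h : H, X.edge h ∈ T ∧ X.source h = a ∧ X.target h = b) u v

/-- The graph is connected (and nonempty). -/
def Connected : Prop := X.ConnectedBy Set.univ

/-- The genus `|E| - |V| + 1`. -/
noncomputable def genus [Fintype V] [Finite H] : ℤ :=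
  (Fintype.card X.Edge : ℤ) - (Fintype.card V : ℤ) + 1

/-- `T` is the edge set of a spanning tree: the spanning subgraph with edge set `T` is connected
and of genus zero, `|T| - |V| + 1 = 0`. -/
def IsSpanningTree [Fintype V] (T : Finset X.Edge) : Prop :=
  X.ConnectedBy (T : Set X.Edge) ∧ (T.card : ℤ) - (Fintype.card V : ℤ) + 1 = 0

open Classical in
/-- The Jacobian polynomial: the sum, over the spanning trees, of the product of the variables
of the complementary edges. -/
noncomputable def jacobianPolynomial [Fintype V] [Finite H] : MvPolynomial X.Edge ℤ :=
  ∑ T : Finset X.Edge with X.IsSpanningTree T, ∏ e ∈ Tᶜ, MvPolynomial.X e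

/-- A closed path: a nonempty sequence of oriented edges in which the target of each one is the
source of the cyclically next one. -/
def IsClosedPath (P : List H) : Prop :=
  P ≠ [] ∧ Cycle.Chain (fun e f => X.target e = X.source f) (P : Cycle H)

/-- A closed path is reduced if no oriented edge in it is followed, cyclically, by its reverse. -/
def IsReduced (P : List H) : Prop :=
  Cycle.Chain (fun e f => f ≠ X.inv e) (P : Cycle H)

/-- A primitive path: a closed reduced path that is not a proper power `Q ^ c`, `c ≥ 2`, of
a closed path `Q`. -/
def IsPrimitive (P : List H) : Prop :=
  X.IsClosedPath P ∧ X.IsReduced P ∧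
    ∀ (Q : List H) (c : ℕ), X.IsClosedPath Q → 2 ≤ c → P ≠ (List.replicate c Q).flatten

/-- Primitive paths up to change of the starting point. -/
def primeSetoid : Setoid {P : List H // X.IsPrimitive P} where
  r P Q := P.1 ~r Q.1
  iseqv :=
    { refl := fun P => List.IsRotated.refl P.1
      symm := fun h => List.IsRotated.symm h
      trans := fun h k => List.IsRotated.trans h k }

/-- The primes of the graph: equivalence classes of primitive paths. -/
def PrimePath : Type _ := Quotient X.primeSetoid

/-- The metric length `M(P) = x e₁ + ⋯ + x eₖ` of a sequence of oriented edges. -/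
def pathLength (x : X.Edge → ℂ) (P : List H) : ℂ := (P.map fun h => x (X.edge h)).sum

/-- The metric length of a prime. -/
def primeLength (x : X.Edge → ℂ) : X.PrimePath → ℂ :=
  Quotient.lift (fun P : {P : List H // X.IsPrimitive P} => X.pathLength x P.1)
    (fun _ _ h => (List.IsRotated.perm h |>.map fun k => x (X.edge k)).sum_eq)

/-- The Euler factor `(1 - s ^ M(P))⁻¹` of a prime (with the principal branch of the power). -/
noncomputable def eulerFactor (x : X.Edge → ℂ) (s : ℂ) (P : X.PrimePath) : ℂ :=
  (1 - s ^ X.primeLength x P)⁻¹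

/-- The metric zeta function, as an Euler product over the primes (to be used where the product
converges). -/
noncomputable def metricZeta (x : X.Edge → ℂ) (s : ℂ) : ℂ :=
  ∏' P : X.PrimePath, X.eulerFactor x s P

/-- `F` is the reciprocal `ζ_M(s, x)⁻¹` of the metric zeta function, analytically continued:
it is holomorphic on the complex plane slit along `(-∞, 0]`, and for all `s` of sufficiently small
modulus in this domain the Euler product converges and `F` is the inverse of its value. -/
def IsReciprocalMetricZeta (x : X.Edge → ℂ) (F : ℂ → ℂ) : Prop :=
  AnalyticOnNhd ℂ F Complex.slitPlane ∧
    ∃ r : ℝ, 0 < r ∧ ∀ s ∈ Complex.slitPlane, ‖s‖ < r →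
      Multipliable (X.eulerFactor x s) ∧ F s * X.metricZeta x s = 1

end SerreGraph

section CauchyBinet

open Matrix

variable {m E R : Type*} [Fintype m] [DecidableEq m] [Fintype E] [DecidableEq E] [CommRing R]

/-- Expansion of `det (B * diagonal c * Bᵀ)` along the rows. -/
theorem Matrix.det_mul_diagonal_mul_transpose_eq_sum_fun (B : Matrix m E R) (c : E → R) :
    (B * diagonal c * Bᵀ).det =
      ∑ f : m → E, (∏ i, B i (f i) * c (f i)) * (B.submatrix id f).det := by
  have h : B * diagonal c * Bᵀ = fun i => ∑ e, (B i e * c e) • Bᵀ e := by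
    ext i j
    rw [Matrix.mul_apply]
    simp [Matrix.mul_diagonal, Finset.sum_apply]
  have := (detRowAlternating (n := m) (R := R)).toMultilinearMap.map_sum
    (fun i (e : E) => (B i e * c e) • Bᵀ e)
  rw [h]
  refine this.trans (Finset.sum_congr rfl fun f _ => ?_)
  rw [MultilinearMap.map_smul_univ, ← det_transpose (B.submatrix id f)]
  rfl

/-- A form of the Cauchy–Binet formula. -/
theorem Matrix.det_mul_diagonal_mul_transpose (B : Matrix m E R) (c : E → R) (D : Finset E → R)
    (hD : ∀ f : m → E, Function.Injective f →
      (B.submatrix id f).det ^ 2 = D (Finset.univ.image f)) :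
    (B * diagonal c * Bᵀ).det =
      ∑ S : Finset E with S.card = Fintype.card m, (∏ e ∈ S, c e) * D S := by
  rw [det_mul_diagonal_mul_transpose_eq_sum_fun, Finset.sum_filter,
    ← Finset.sum_fiberwise Finset.univ (fun f : m → E => Finset.univ.image f)]
  refine Finset.sum_congr rfl fun S _ => ?_
  split_ifs with hS
  · obtain ⟨σ⟩ : Nonempty (m ≃ S) := ⟨Fintype.equivOfCardEq (by simp [hS])⟩
    set τ : m → E := fun i => σ i with hτ
    have hτi : Function.Injective τ := Subtype.val_injective.comp σ.injective
    have himg : ∀ π : Equiv.Perm m, Finset.univ.image (τ ∘ π) = S := by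
      intro π
      refine Finset.eq_of_subset_of_card_le (fun e he => ?_) ?_
      · obtain ⟨i, -, rfl⟩ := Finset.mem_image.1 he
        exact (σ (π i)).2
      · rw [Finset.card_image_of_injective _ (hτi.comp π.injective), hS, Finset.card_univ]
    have hbij : ∑ f : m → E with Finset.univ.image f = S,
        (∏ i, B i (f i) * c (f i)) * (B.submatrix id f).det =
        ∑ π : Equiv.Perm m, (∏ i, B i (τ (π i)) * c (τ (π i))) * (B.submatrix id (τ ∘ π)).det := by
      symm
      refine Finset.sum_nbij (fun π => τ ∘ π) ?_ ?_ ?_ ?_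
      · intro π _
        simpa using himg π
      · intro π _ π' _ h
        ext i
        exact hτi (congrFun h i)
      · intro f hf
        simp only [Finset.coe_filter, Finset.mem_univ, true_and, Set.mem_ofPred_eq] at hf
        have hfS : ∀ i, f i ∈ S := fun i => hf ▸ Finset.mem_image_of_mem f (Finset.mem_univ i)
        have hfi : Function.Injective f := by
          have := Finset.card_image_iff.1 (show (Finset.univ.image f).card = Finset.univ.card by
            rw [hf, hS, Finset.card_univ])
          simpa [Set.injOn_univ] using this
        let π : m → m := fun i => σ.symm ⟨f i, hfS i⟩
        have hπ : Function.Injective π := fun i j h => hfi (by simpa [π] using h)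
        refine ⟨Equiv.ofBijective π (Finite.injective_iff_bijective.1 hπ), by simp, ?_⟩
        ext i
        simp [hτ, π]
      · intro π _
        rfl
    rw [hbij]
    have hdet : ∀ π : Equiv.Perm m, (B.submatrix id (τ ∘ π)).det =
        Equiv.Perm.sign π * (B.submatrix id τ).det := fun π => by
      rw [← det_permute' π (B.submatrix id τ), submatrix_submatrix]
      rfl
    have hc : ∀ π : Equiv.Perm m, ∏ i, c (τ (π i)) = ∏ e ∈ S, c e := fun π => by
      rw [← himg π, Finset.prod_image fun i _ j _ h => hτi.comp π.injective h]
      rfl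
    simp_rw [hdet, Finset.prod_mul_distrib, hc]
    have hS' : D S = (B.submatrix id τ).det ^ 2 := by
      rw [hD τ hτi]
      exact congrArg D (himg 1).symm
    have hexp : (B.submatrix id τ).det = ∑ π : Equiv.Perm m, Equiv.Perm.sign π *
        ∏ i, B i (τ (π i)) := by
      rw [← det_transpose, det_apply']
      rfl
    rw [hS', sq]
    nth_rw 2 [hexp]
    rw [Finset.sum_mul, Finset.mul_sum]
    exact Finset.sum_congr rfl fun π _ => by ring
  · refine Finset.sum_eq_zero fun f hf => ?_
    have hf' : ¬ Function.Injective f := fun h => hS <| by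
      rw [← (Finset.mem_filter.1 hf).2, Finset.card_image_of_injective _ h, Finset.card_univ]
    obtain ⟨i, j, hij, hne⟩ := Function.not_injective_iff.1 hf'
    rw [det_zero_of_column_eq hne fun k => by simp [hij], mul_zero]

end CauchyBinet

namespace SerreGraph

variable {V H : Type*} (X : SerreGraph V H)

/-- A chosen oriented edge over each edge. -/
noncomputable def orient (e : X.Edge) : H := Quotient.out e

@[simp] theorem edge_orient (e : X.Edge) : X.edge (X.orient e) = e := Quotient.out_eq e

@[simp] theorem edge_inv (h : H) : X.edge (X.inv h) = X.edge h :=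
  Quotient.sound (s := X.edgeSetoid) (Or.inr (X.inv_inv h).symm)

theorem eq_or_eq_inv_of_edge_eq {h k : H} (hk : X.edge h = X.edge k) : k = h ∨ k = X.inv h :=
  Quotient.exact (s := X.edgeSetoid) hk

@[simp] theorem source_inv (h : H) : X.source (X.inv h) = X.target h := rfl

@[simp] theorem target_inv (h : H) : X.target (X.inv h) = X.source h := by
  simp [target, source, X.inv_inv]

theorem orient_edge (h : H) : X.orient (X.edge h) = h ∨ X.orient (X.edge h) = X.inv h :=
  X.eq_or_eq_inv_of_edge_eq (X.edge_orient _).symm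

/-- Oriented edges correspond to edges with one of two orientations. -/
noncomputable def edgeSumEquiv : X.Edge ⊕ X.Edge ≃ H :=
  Equiv.ofBijective (Sum.elim X.orient fun e => X.inv (X.orient e)) <| by
    constructor
    · rintro (e | e) (e' | e') h
      · simpa using congrArg X.edge h
      · have := congrArg X.edge h
        simp only [Sum.elim_inl, Sum.elim_inr, edge_orient, edge_inv] at this
        subst this
        exact absurd h.symm (X.inv_ne _)
      · have := congrArg X.edge h
        simp only [Sum.elim_inl, Sum.elim_inr, edge_orient, edge_inv] at this
        subst this
        exact absurd h (X.inv_ne _)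
      · simpa using congrArg X.edge h
    · intro h
      rcases X.orient_edge h with hh | hh
      · exact ⟨Sum.inl (X.edge h), hh⟩
      · exact ⟨Sum.inr (X.edge h), by simp [hh, X.inv_inv]⟩

@[simp] theorem edgeSumEquiv_inl (e : X.Edge) : X.edgeSumEquiv (Sum.inl e) = X.orient e := rfl

@[simp] theorem edgeSumEquiv_inr (e : X.Edge) : X.edgeSumEquiv (Sum.inr e) = X.inv (X.orient e) :=
  rfl

@[simp] theorem orient_inj {e e' : X.Edge} : X.orient e = X.orient e' ↔ e = e' :=
  (X.edgeSumEquiv.injective.eq_iff (a := .inl e) (b := .inl e')).trans Sum.inl_injective.eq_iff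

@[simp] theorem inv_inj {h k : H} : X.inv h = X.inv k ↔ h = k :=
  (Function.LeftInverse.injective X.inv_inv).eq_iff

theorem orient_ne_inv_orient (e e' : X.Edge) : X.orient e ≠ X.inv (X.orient e') := fun h => by
  have h' : X.edgeSumEquiv (.inl e) = X.edgeSumEquiv (.inr e') := h
  exact absurd (X.edgeSumEquiv.injective h') Sum.inl_ne_inr

theorem sum_halfEdge [Fintype H] {R : Type*} [AddCommMonoid R] (f : H → R) :
    ∑ h, f h = ∑ e : X.Edge, (f (X.orient e) + f (X.inv (X.orient e))) := by
  rw [← X.edgeSumEquiv.sum_comp, Fintype.sum_sum_type, Finset.sum_add_distrib]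
  rfl

theorem prod_halfEdge [Fintype H] {R : Type*} [CommMonoid R] (f : H → R) :
    ∏ h, f h = ∏ e : X.Edge, (f (X.orient e) * f (X.inv (X.orient e))) := by
  rw [← X.edgeSumEquiv.prod_comp, Fintype.prod_sum_type, Finset.prod_mul_distrib]
  rfl

theorem card_halfEdge [Fintype H] : Fintype.card H = 2 * Fintype.card X.Edge := by
  rw [← Fintype.card_congr X.edgeSumEquiv, Fintype.card_sum, two_mul]

/-- Adjacency through an edge of `T`. -/
def StepIn (T : Set X.Edge) (a b : V) : Prop :=
  ∃ h : H, X.edge h ∈ T ∧ X.source h = a ∧ X.target h = b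

theorem StepIn.symm {T : Set X.Edge} {a b : V} (h : X.StepIn T a b) : X.StepIn T b a := by
  obtain ⟨h, hT, rfl, rfl⟩ := h
  exact ⟨X.inv h, by simpa using hT, by simp, by simp⟩

theorem connectedBy_of_forall_reachable {T : Set X.Edge} (v₀ : V)
    (h : ∀ v, Relation.ReflTransGen (X.StepIn T) v₀ v) : X.ConnectedBy T :=
  ⟨⟨v₀⟩, fun u v =>
    haveI : Std.Symm (X.StepIn T) := ⟨fun _ _ => StepIn.symm X⟩
    (Relation.ReflTransGen.stdSymm.symm _ _ (h u)).trans (h v)⟩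

open Classical in
/-- The oriented incidence matrix. -/
noncomputable def incMatrix : Matrix V X.Edge ℤ :=
  Matrix.of fun v e =>
    (if X.target (X.orient e) = v then 1 else 0) - (if X.source (X.orient e) = v then 1 else 0)

section MatrixTree

variable [DecidableEq V] (v₀ : V)

/-- The incidence matrix with the row of `v₀` removed. -/
noncomputable def reducedIncMatrix : Matrix {v // v ≠ v₀} X.Edge ℤ :=
  X.incMatrix.submatrix Subtype.val id

theorem incMatrix_apply (v : V) (e : X.Edge) : X.incMatrix v e =
    (if X.target (X.orient e) = v then 1 else 0) -
      (if X.source (X.orient e) = v then 1 else 0) := by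
  simp only [incMatrix, Matrix.of_apply]
  congr

/-- A path from `v₀` to `v` in `T` is a linear combination of edges of `T` with boundary
`v - v₀`. -/
theorem exists_boundary_eq {ι : Type*} [Fintype ι] [DecidableEq ι] (f : ι → X.Edge) {v : V}
    (h : Relation.ReflTransGen (X.StepIn (Set.range f)) v₀ v) :
    ∃ p : ι → ℤ, ∀ u, ∑ i, X.incMatrix u (f i) * p i =
      (if v = u then 1 else 0) - (if v₀ = u then 1 else 0) := by
  induction h with
  | refl => exact ⟨0, by simp⟩
  | tail _ hab ih =>
    obtain ⟨p, hp⟩ := ih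
    obtain ⟨h, ⟨i, hi⟩, rfl, rfl⟩ := hab
    rcases X.orient_edge h with ho | ho
    · refine ⟨p + Pi.single i 1, fun u => ?_⟩
      simp only [Pi.add_apply, mul_add, Finset.sum_add_distrib, hp]
      simp [Pi.single_apply, incMatrix_apply, hi, ho]
    · refine ⟨p - Pi.single i 1, fun u => ?_⟩
      simp only [Pi.sub_apply, mul_sub, Finset.sum_sub_distrib, hp]
      simp [Pi.single_apply, incMatrix_apply, hi, ho]

/-- The weighted Laplacian with the row and the column of `v₀` removed. -/
noncomputable def reducedLaplacian [Fintype H] (c : X.Edge → ℂ) :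
    Matrix {v // v ≠ v₀} {v // v ≠ v₀} ℂ :=
  Matrix.of fun u v => (if u = v then ∑ h, if X.source h = u then c (X.edge h) else 0 else 0) -
    ∑ h, if X.source h = u ∧ X.target h = v then c (X.edge h) else 0

theorem reducedLaplacian_eq [Fintype H] (c : X.Edge → ℂ) : X.reducedLaplacian v₀ c =
    (X.reducedIncMatrix v₀).map (Int.cast : ℤ → ℂ) * Matrix.diagonal c *
      ((X.reducedIncMatrix v₀).map (Int.cast : ℤ → ℂ)).transpose := by
  ext ⟨u, hu⟩ ⟨v, hv⟩
  rw [Matrix.mul_apply]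
  simp only [reducedLaplacian, Matrix.of_apply, X.sum_halfEdge, Matrix.mul_diagonal,
    Matrix.map_apply, Matrix.transpose_apply, reducedIncMatrix, Matrix.submatrix_apply, id,
    incMatrix_apply, edge_inv, edge_orient, source_inv, target_inv, Subtype.mk.injEq]
  by_cases huv : u = v
  · subst huv
    rw [if_pos rfl, ← Finset.sum_sub_distrib]
    refine Finset.sum_congr rfl fun e _ => ?_
    by_cases h1 : X.source (X.orient e) = u <;> by_cases h2 : X.target (X.orient e) = u <;>
      simp [h1, h2]
  · rw [if_neg huv, zero_sub, ← Finset.sum_neg_distrib]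
    refine Finset.sum_congr rfl fun e _ => ?_
    by_cases h1 : X.source (X.orient e) = u <;> by_cases h2 : X.target (X.orient e) = u <;>
    by_cases h3 : X.source (X.orient e) = v <;> by_cases h4 : X.target (X.orient e) = v <;>
      simp_all

variable [Fintype V]

theorem det_sq_reducedIncMatrix_of_connectedBy (f : {v // v ≠ v₀} → X.Edge)
    (hf : X.ConnectedBy (Set.range f)) :
    ((X.reducedIncMatrix v₀).submatrix id f).det ^ 2 = 1 := by
  choose p hp using fun v => X.exists_boundary_eq v₀ f (hf.2 v₀ v)
  have hmul : ((X.reducedIncMatrix v₀).submatrix id f) *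
      (Matrix.of fun i (v : {v // v ≠ v₀}) => p v i) = 1 := by
    ext u v
    simp only [Matrix.mul_apply, Matrix.submatrix_apply, reducedIncMatrix, Matrix.of_apply, id, hp,
      Matrix.one_apply, if_neg u.2.symm, sub_zero, Subtype.ext_iff, eq_comm]
  have hu : IsUnit ((X.reducedIncMatrix v₀).submatrix id f).det :=
    IsUnit.of_mul_eq_one _ (by rw [← Matrix.det_mul, hmul, Matrix.det_one])
  rcases Int.isUnit_iff.1 hu with h | h <;> simp [h]

theorem det_reducedIncMatrix_of_not_connectedBy (f : {v // v ≠ v₀} → X.Edge)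
    (hf : ¬ X.ConnectedBy (Set.range f)) :
    ((X.reducedIncMatrix v₀).submatrix id f).det = 0 := by
  classical
  obtain ⟨v, hv⟩ : ∃ v, ¬ Relation.ReflTransGen (X.StepIn (Set.range f)) v₀ v := by
    by_contra! h
    exact hf (X.connectedBy_of_forall_reachable v₀ h)
  let z : V → ℤ := fun u =>
    if Relation.ReflTransGen (X.StepIn (Set.range f)) v₀ u then 0 else 1
  have hz₀ : z v₀ = 0 := if_pos .refl
  have hvne : v ≠ v₀ := by
    rintro rfl
    exact hv .refl
  refine Matrix.exists_vecMul_eq_zero_iff.1 ⟨fun u => z u, fun h => ?_, ?_⟩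
  · simpa [z, hv] using congrFun h ⟨v, hvne⟩
  · ext i
    have hst : z (X.source (X.orient (f i))) = z (X.target (X.orient (f i))) := by
      have hstep : X.StepIn (Set.range f) (X.source (X.orient (f i)))
          (X.target (X.orient (f i))) := ⟨_, by simp, rfl, rfl⟩
      simp only [z]
      congr 1
      exact propext ⟨fun h => h.tail hstep, fun h => h.tail (hstep.symm X)⟩
    have hsum : ∑ u, z u * X.incMatrix u (f i) = 0 := by
      simp [incMatrix_apply, mul_sub, hst]
    simp only [Matrix.vecMul, dotProduct, Matrix.submatrix_apply, reducedIncMatrix, id,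
      Pi.zero_apply]
    rw [← hsum]
    rw [← Fintype.sum_subtype_add_sum_subtype (fun u => u ≠ v₀),
      Fintype.sum_eq_zero (fun u : {u // ¬ u ≠ v₀} => _) (fun u => ?_), add_zero]
    rw [not_ne_iff.1 u.2, hz₀, zero_mul]

open Classical in
/-- The weighted matrix-tree theorem. -/
theorem det_reducedLaplacian [Fintype H] (c : X.Edge → ℂ) : (X.reducedLaplacian v₀ c).det =
    ∑ T : Finset X.Edge with X.IsSpanningTree T, ∏ e ∈ T, c e := by
  rw [reducedLaplacian_eq, Matrix.det_mul_diagonal_mul_transpose _ _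
    (fun S => if X.ConnectedBy (S : Set X.Edge) then 1 else 0), Finset.sum_filter,
    Finset.sum_filter]
  · refine Finset.sum_congr rfl fun S _ => ?_
    have hcard : Fintype.card {v // v ≠ v₀} + 1 = Fintype.card V := by
      have := Fintype.card_pos_iff.2 ⟨v₀⟩
      rw [Fintype.card_subtype_compl, Fintype.card_subtype_eq]
      omega
    by_cases h1 : X.ConnectedBy (S : Set X.Edge) <;>
      by_cases h2 : S.card = Fintype.card {v // v ≠ v₀}
    · have : X.IsSpanningTree S := ⟨h1, by omega⟩
      simp [h1, h2, this, -Fintype.card_subtype_compl]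
    · have : ¬ X.IsSpanningTree S := fun h => h2 (by have := h.2; omega)
      simp [h2, this, -Fintype.card_subtype_compl]
    all_goals
      have : ¬ X.IsSpanningTree S := fun h => h1 h.1
      simp [h1, this]
  · intro f _
    have hdet : ((((X.reducedIncMatrix v₀).map (Int.cast : ℤ → ℂ)).submatrix id f).det : ℂ) =
        (((X.reducedIncMatrix v₀).submatrix id f).det : ℤ) := by
      rw [Int.cast_det]
      rfl
    rw [hdet, Finset.coe_image, Finset.coe_univ, Set.image_univ]
    split_ifs with h
    · exact_mod_cast X.det_sq_reducedIncMatrix_of_connectedBy v₀ f h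
    · rw [X.det_reducedIncMatrix_of_not_connectedBy v₀ f h]
      simp

end MatrixTree

end SerreGraph

namespace SerreGraph

variable {V H : Type*} (X : SerreGraph V H)

section Bass

variable [DecidableEq H]

/-- The weighted matrix of orientation reversal. -/
noncomputable def reversalMatrix (y : X.Edge → ℂ) : Matrix H H ℂ :=
  Matrix.of fun h k => if k = X.inv h then y (X.edge h) else 0

section Reversal

variable [Fintype H]

theorem reversalMatrix_mul_apply {n : Type*} (y : X.Edge → ℂ) (A : Matrix H n ℂ) (h : H) (j : n) :
    (X.reversalMatrix y * A) h j = y (X.edge h) * A (X.inv h) j := by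
  simp [Matrix.mul_apply, reversalMatrix]

theorem reversalMatrix_mul_self (y : X.Edge → ℂ) : X.reversalMatrix y * X.reversalMatrix y =
    Matrix.diagonal fun h => y (X.edge h) ^ 2 := by
  ext h k
  rw [reversalMatrix_mul_apply]
  simp only [reversalMatrix, Matrix.of_apply, X.inv_inv, edge_inv, Matrix.diagonal_apply,
    eq_comm (a := k)]
  split_ifs <;> ring

theorem det_one_sub_reversalMatrix (y : X.Edge → ℂ) :
    (1 - X.reversalMatrix y).det = ∏ e, (1 - y e ^ 2) := by
  have h : (1 - X.reversalMatrix y).submatrix X.edgeSumEquiv X.edgeSumEquiv =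
      Matrix.fromBlocks 1 (-Matrix.diagonal y) (-Matrix.diagonal y) 1 := by
    ext (e | e) (e' | e')
    · simp [reversalMatrix, X.orient_ne_inv_orient, Matrix.one_apply]
    · rcases eq_or_ne e e' with rfl | h
      · simp [reversalMatrix, X.orient_ne_inv_orient]
      · simp [reversalMatrix, X.orient_ne_inv_orient, h, h.symm]
    · rcases eq_or_ne e e' with rfl | h
      · simp [reversalMatrix, (X.orient_ne_inv_orient _ _).symm, X.inv_inv]
      · simp [reversalMatrix, (X.orient_ne_inv_orient _ _).symm, X.inv_inv, h, h.symm]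
    · simp [reversalMatrix, (X.orient_ne_inv_orient _ _).symm, Matrix.one_apply, X.inv_inv]
  rw [← Matrix.det_submatrix_equiv_self X.edgeSumEquiv, h, Matrix.det_fromBlocks_one₁₁,
    Matrix.neg_mul, Matrix.mul_neg, neg_neg, Matrix.diagonal_mul_diagonal, ← Matrix.diagonal_one,
    Matrix.diagonal_sub, Matrix.det_diagonal]
  simp [sq]

end Reversal

variable [DecidableEq V]

/-- The weighted non-backtracking (Hashimoto) edge adjacency matrix. -/
noncomputable def edgeMatrix (y : X.Edge → ℂ) : Matrix H H ℂ :=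
  Matrix.of fun h k => if X.target h = X.source k ∧ k ≠ X.inv h then y (X.edge h) else 0

/-- The matrix of the target map. -/
def targetMatrix : Matrix H V ℂ := Matrix.of fun h v => if X.target h = v then 1 else 0

/-- The matrix of the source map. -/
def sourceMatrix : Matrix V H ℂ := Matrix.of fun v h => if X.source h = v then 1 else 0

variable [Fintype H]

/-- The vertex matrix in Bass's determinant formula. -/
noncomputable def bassMatrix (y : X.Edge → ℂ) : Matrix V V ℂ :=
  Matrix.of fun u v => (if u = v then 1 + ∑ h, if X.source h = u then
      y (X.edge h) ^ 2 / (1 - y (X.edge h) ^ 2) else 0 else 0) -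
    ∑ h, if X.source h = u ∧ X.target h = v then y (X.edge h) / (1 - y (X.edge h) ^ 2) else 0

theorem edgeMatrix_eq [Fintype V] (y : X.Edge → ℂ) : X.edgeMatrix y =
    Matrix.diagonal (fun h => y (X.edge h)) * X.targetMatrix * X.sourceMatrix -
      X.reversalMatrix y := by
  ext h k
  rw [Matrix.sub_apply, Matrix.mul_apply]
  simp only [Matrix.diagonal_mul, targetMatrix, sourceMatrix, Matrix.of_apply, edgeMatrix,
    reversalMatrix, mul_ite, mul_one, mul_zero, Finset.sum_ite_eq, Finset.mem_univ, if_true]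
  by_cases h1 : k = X.inv h
  · subst h1
    simp
  · by_cases h2 : X.target h = X.source k
    · simp [h1, h2]
    · simp [h1, h2]

/-- Bass's determinant formula with edge weights. -/
theorem det_one_sub_edgeMatrix [Fintype V] (y : X.Edge → ℂ) (hy : ∀ e, 1 - y e ^ 2 ≠ 0) :
    (1 - X.edgeMatrix y).det = (∏ e, (1 - y e ^ 2)) * (X.bassMatrix y).det := by
  set K := X.reversalMatrix y with hK
  set Y : Matrix H H ℂ := Matrix.diagonal (fun h => y (X.edge h)) with hY
  set Q : Matrix H H ℂ := Matrix.diagonal (fun h => 1 - y (X.edge h) ^ 2) with hQ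
  set R : Matrix H H ℂ := Matrix.diagonal (fun h => (1 - y (X.edge h) ^ 2)⁻¹) with hR
  have hQR : Q * R = 1 := by
    rw [hQ, hR, Matrix.diagonal_mul_diagonal, ← Matrix.diagonal_one]
    congr 1
    ext h
    exact mul_inv_cancel₀ (hy _)
  have hKK : (1 - K) * (1 + K) = Q := by
    have : (1 - K) * (1 + K) = 1 - K * K := by noncomm_ring
    rw [this, hK, reversalMatrix_mul_self, ← Matrix.diagonal_one, Matrix.diagonal_sub]
  have hmul : (1 - K) * (1 - X.edgeMatrix y) =
      Q * (1 - (R * ((1 - K) * (Y * X.targetMatrix))) * X.sourceMatrix) := by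
    have h1 : (1 - K) * (1 - X.edgeMatrix y) =
        (1 - K) * (1 + K) - (1 - K) * (Y * X.targetMatrix) * X.sourceMatrix := by
      rw [edgeMatrix_eq, Matrix.mul_assoc (1 - K), ← Matrix.mul_sub]
      congr 1
      abel
    rw [h1, hKK, Matrix.mul_sub, Matrix.mul_one, Matrix.mul_assoc R, ← Matrix.mul_assoc Q R, hQR,
      Matrix.one_mul]
  have hbass : 1 - X.sourceMatrix * (R * ((1 - K) * (Y * X.targetMatrix))) = X.bassMatrix y := by
    ext u v
    rw [Matrix.sub_apply, Matrix.mul_apply]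
    simp only [hR, Matrix.diagonal_mul, Matrix.sub_mul, Matrix.one_mul, Matrix.sub_apply, hK,
      reversalMatrix_mul_apply, hY, edge_inv, sourceMatrix, targetMatrix, Matrix.of_apply,
      target_inv, bassMatrix, Matrix.one_apply]
    by_cases huv : u = v
    · subst huv
      rw [if_pos rfl, if_pos rfl, add_sub_assoc, sub_eq_add_neg, ← Finset.sum_sub_distrib,
        ← Finset.sum_neg_distrib]
      congr 1
      refine Finset.sum_congr rfl fun h _ => ?_
      by_cases h1 : X.source h = u <;> by_cases h2 : X.target h = u <;> simp [h1, h2] <;> ring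
    · rw [if_neg huv, if_neg huv]
      congr 1
      refine Finset.sum_congr rfl fun h _ => ?_
      by_cases h1 : X.source h = u
      · have h3 : X.source h ≠ v := fun h => huv (h1.symm.trans h)
        by_cases h2 : X.target h = v
        · simp [h1, h2, huv]
          ring
        · simp [h1, h2, huv]
      · simp [h1]
  have hdet := congrArg Matrix.det hmul
  rw [Matrix.det_mul, Matrix.det_mul, Matrix.det_one_sub_mul_comm, hbass, hQ, Matrix.det_diagonal,
    X.prod_halfEdge, hK, det_one_sub_reversalMatrix] at hdet
  simp only [edge_orient, edge_inv, Finset.prod_mul_distrib, mul_assoc] at hdet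
  exact mul_left_cancel₀ (Finset.prod_ne_zero_iff.2 fun e _ => hy e) hdet

end Bass

end SerreGraph

namespace List

variable {α : Type*}

/-- The `k`-th power of a word. -/
def wordPow (Q : List α) (k : ℕ) : List α := (replicate k Q).flatten

@[simp] theorem wordPow_zero (Q : List α) : Q.wordPow 0 = [] := rfl

theorem wordPow_succ (Q : List α) (k : ℕ) : Q.wordPow (k + 1) = Q ++ Q.wordPow k := rfl

@[simp] theorem length_wordPow (Q : List α) (k : ℕ) : (Q.wordPow k).length = k * Q.length := by
  simp [wordPow]

@[simp] theorem nil_wordPow (k : ℕ) : ([] : List α).wordPow k = [] := by simp [wordPow]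

theorem wordPow_cons_append_singleton (a : α) (l : List α) (k : ℕ) :
    (a :: l).wordPow k ++ [a] = a :: (l ++ [a]).wordPow k := by
  induction k with
  | zero => rfl
  | succ k ih => simp [wordPow_succ, ih]

theorem rotate_one_wordPow (Q : List α) (k : ℕ) :
    (Q.wordPow k).rotate 1 = (Q.rotate 1).wordPow k := by
  cases k with
  | zero => simp
  | succ k =>
    cases Q with
    | nil => simp
    | cons a l =>
      simp [wordPow_succ, wordPow_cons_append_singleton]

theorem wordPow_left_injective {k : ℕ} (hk : k ≠ 0) :
    Function.Injective fun Q : List α => Q.wordPow k := by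
  intro Q Q' h
  obtain ⟨k, rfl⟩ := Nat.exists_eq_succ_of_ne_zero hk
  have hl := congrArg length h
  simp only [length_wordPow] at hl
  exact (append_inj h (Nat.eq_of_mul_eq_mul_left k.succ_pos hl)).1

theorem iterate_rotate_one (l : List α) (n : ℕ) :
    (fun l : List α => l.rotate 1)^[n] l = l.rotate n := by
  induction n with
  | zero => simp
  | succ n ih => rw [Function.iterate_succ_apply', ih, rotate_rotate]

/-- The length of the shortest nontrivial rotation that fixes a word. -/
noncomputable def rotationPeriod (l : List α) : ℕ :=
  Function.minimalPeriod (fun l : List α => l.rotate 1) l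

theorem rotate_eq_self_iff_rotationPeriod_dvd {l : List α} {n : ℕ} :
    l.rotate n = l ↔ l.rotationPeriod ∣ n := by
  rw [rotationPeriod, ← Function.isPeriodicPt_iff_minimalPeriod_dvd, Function.IsPeriodicPt,
    Function.IsFixedPt, iterate_rotate_one]

theorem rotate_wordPow (Q : List α) (k n : ℕ) :
    (Q.wordPow k).rotate n = (Q.rotate n).wordPow k := by
  induction n with
  | zero => simp
  | succ n ih => rw [← rotate_rotate, ih, rotate_one_wordPow, rotate_rotate]

theorem rotationPeriod_wordPow (Q : List α) {k : ℕ} (hk : k ≠ 0) :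
    (Q.wordPow k).rotationPeriod = Q.rotationPeriod := by
  refine Nat.dvd_antisymm ?_ ?_ <;> rw [← rotate_eq_self_iff_rotationPeriod_dvd]
  · rw [rotate_wordPow, rotate_eq_self_iff_rotationPeriod_dvd.2 dvd_rfl]
  · have h := rotate_eq_self_iff_rotationPeriod_dvd.2 (dvd_refl (Q.wordPow k).rotationPeriod)
    rw [rotate_wordPow] at h
    exact wordPow_left_injective hk h

theorem rotationPeriod_dvd_length (l : List α) : l.rotationPeriod ∣ l.length :=
  rotate_eq_self_iff_rotationPeriod_dvd.1 l.rotate_length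

theorem eq_wordPow_of_append_comm {A : List α} (m : ℕ) : ∀ {B : List α}, A ++ B = B ++ A →
    B.length = m * A.length → B = A.wordPow m := by
  induction m with
  | zero =>
    intro B _ hl
    simpa using hl
  | succ m ih =>
    intro B h hl
    have hpre : A <+: B := prefix_of_prefix_length_le (prefix_append A B)
      (h ▸ prefix_append B A) (by rw [hl]; exact Nat.le_mul_of_pos_left _ m.succ_pos)
    obtain ⟨C, rfl⟩ := hpre
    rw [wordPow_succ, ← ih (B := C)]
    · simpa using h
    · rw [length_append, Nat.succ_mul] at hl
      omega

theorem eq_wordPow_take_of_rotate_eq {l : List α} {d m : ℕ} (hl : l.length = m * d)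
    (h : l.rotate d = l) : l = (l.take d).wordPow m := by
  cases m with
  | zero => simpa using hl
  | succ m =>
    have hd : d ≤ l.length := hl ▸ Nat.le_mul_of_pos_left _ m.succ_pos
    rw [rotate_eq_drop_append_take hd] at h
    have hdrop := eq_wordPow_of_append_comm (A := l.take d) (B := l.drop d) m
      (by rw [h, take_append_drop])
      (by rw [length_drop, length_take, min_eq_left hd, hl, Nat.succ_mul, Nat.add_sub_cancel])
    rw [wordPow_succ, ← hdrop, take_append_drop]

/-- Every nonempty word is a power of a word whose rotation period is its length. -/
theorem exists_eq_wordPow {l : List α} (hl : l ≠ []) : ∃ (Q : List α) (k : ℕ),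
    Q ≠ [] ∧ Q.rotationPeriod = Q.length ∧ l = Q.wordPow (k + 1) := by
  obtain ⟨m, hm⟩ := l.rotationPeriod_dvd_length
  have hpos : 0 < l.length := length_pos_iff.2 hl
  have hd : l.rotationPeriod ≤ l.length := Nat.le_of_dvd hpos l.rotationPeriod_dvd_length
  have heq := eq_wordPow_take_of_rotate_eq (m := m) (by rw [hm, mul_comm])
    (rotate_eq_self_iff_rotationPeriod_dvd.2 (dvd_refl l.rotationPeriod))
  obtain ⟨k, rfl⟩ : ∃ k, m = k + 1 := Nat.exists_eq_succ_of_ne_zero (by rintro rfl; omega)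
  refine ⟨l.take l.rotationPeriod, k, ?_, ?_, heq⟩
  · intro h
    rw [h, nil_wordPow] at heq
    exact hl heq
  · rw [length_take, min_eq_left hd, ← rotationPeriod_wordPow _ k.succ_ne_zero, ← heq]

theorem prod_map_wordPow {M : Type*} [CommMonoid M] (f : α → M) (Q : List α) (k : ℕ) :
    ((Q.wordPow k).map f).prod = (Q.map f).prod ^ k := by
  induction k with
  | zero => simp
  | succ k ih => rw [wordPow_succ, map_append, prod_append, ih, pow_succ']

theorem wordPow_ne_nil {Q : List α} (hQ : Q ≠ []) (k : ℕ) : Q.wordPow (k + 1) ≠ [] := by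
  simp [wordPow_succ, hQ]

theorem cycleChain_wordPow (r : α → α → Prop) (Q : List α) (k : ℕ) :
    Cycle.Chain r (Q.wordPow (k + 1) : Cycle α) ↔ Cycle.Chain r (Q : Cycle α) := by
  cases Q with
  | nil => simp
  | cons a l =>
    have key : ∀ k, IsChain r ((a :: l).wordPow (k + 1) ++ [a]) ↔ IsChain r (a :: (l ++ [a])) := by
      intro k
      induction k with
      | zero => simp [wordPow_succ]
      | succ k ih =>
        rw [wordPow_succ, append_assoc]
        conv_lhs => rw [wordPow_cons_append_singleton]
        rw [isChain_split, ← wordPow_cons_append_singleton, ih]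
        simp
    rw [Cycle.chain_coe_cons, ← key k, wordPow_succ, cons_append, Cycle.chain_coe_cons, cons_append]

theorem isChain_and_iff {r s : α → α → Prop} {l : List α} :
    IsChain (fun a b => r a b ∧ s a b) l ↔ IsChain r l ∧ IsChain s l := by
  induction l using twoStepInduction with
  | nil => simp
  | singleton a => simp
  | cons_cons a b l _ ih =>
    simp only [isChain_cons_cons, ih]
    tauto

theorem cycleChain_and_iff {r s : α → α → Prop} {l : List α} :
    Cycle.Chain (fun a b => r a b ∧ s a b) (l : Cycle α) ↔
      Cycle.Chain r (l : Cycle α) ∧ Cycle.Chain s (l : Cycle α) := by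
  cases l with
  | nil => simp
  | cons a l => simp only [Cycle.chain_coe_cons, isChain_and_iff]

end List

open Matrix Polynomial in
/-- The eigenvalues of a power of a matrix are the powers of the eigenvalues. -/
theorem Matrix.trace_pow_eq_sum_roots {n : Type*} [Fintype n] [DecidableEq n] (A : Matrix n n ℂ)
    (k : ℕ) : (A ^ k).trace = (A.charpoly.roots.map (· ^ k)).sum := by
  have hneg : ∀ (s : Multiset ℂ) (f : ℂ → ℂ),
      (s.map fun r => -f r).prod = (-1) ^ Multiset.card s * (s.map f).prod := by
    intro s f
    rw [← Multiset.card_map f, ← Multiset.prod_map_neg, Multiset.map_map]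
    rfl
  have hcard : Multiset.card A.charpoly.roots = Fintype.card n := by
    rw [← (IsAlgClosed.splits A.charpoly).natDegree_eq_card_roots,
      Matrix.charpoly_natDegree_eq_dim]
  have hdet : ∀ z : ℂ, (A - z • 1).det = (A.charpoly.roots.map (· - z)).prod := by
    intro z
    have h1 := (IsAlgClosed.splits A.charpoly).eval_eq_prod_roots_of_monic A.charpoly_monic z
    rw [Matrix.eval_charpoly] at h1
    have h2 : A - z • 1 = -(Matrix.scalar n z - A) := by
      rw [neg_sub, Matrix.scalar_apply, Matrix.smul_one_eq_diagonal]
    rw [h2, Matrix.det_neg, h1, ← hcard, ← hneg]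
    simp
  have haeval : ∀ p : ℂ[X], p.Monic → (aeval A p).det = (A.charpoly.roots.map p.eval).prod := by
    intro p hp
    have hpr := (IsAlgClosed.splits p).eq_prod_roots_of_monic hp
    generalize p.roots = s at hpr
    subst hpr
    clear hp
    induction s using Multiset.induction_on with
    | empty => simp
    | cons a s ih =>
      simp only [Multiset.map_cons, Multiset.prod_cons, map_mul, Matrix.det_mul, ih, eval_mul,
        Multiset.prod_map_mul]
      congr 1
      simpa [Algebra.algebraMap_eq_smul_one] using hdet a
  rcases Nat.eq_zero_or_pos k with rfl | hk
  · simp [← (IsAlgClosed.splits A.charpoly).natDegree_eq_card_roots]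
  have hchar : (A ^ k).charpoly = (A.charpoly.roots.map fun r => X - C (r ^ k)).prod := by
    refine Polynomial.funext fun z => ?_
    have h := haeval (X ^ k - C z) (monic_X_pow_sub_C z hk.ne')
    have h2 : aeval A (X ^ k - C z) = -(Matrix.scalar n z - A ^ k) := by
      simp [Matrix.algebraMap_eq_diagonal, Matrix.scalar_apply]
    rw [Matrix.eval_charpoly, ← neg_neg (Matrix.scalar n z - A ^ k), ← h2, Matrix.det_neg, h,
      ← hcard, ← hneg, eval_multiset_prod, Multiset.map_map]
    simp
  rw [Matrix.trace_eq_sum_roots_charpoly, hchar]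
  have : (A.charpoly.roots.map fun r => X - C (r ^ k)).prod =
      ((A.charpoly.roots.map (· ^ k)).map fun r => X - C r).prod := by simp
  rw [this, roots_multiset_prod_X_sub_C]

/-- For a multiset of complex numbers of norm less than one, the sum of the logarithms. -/
theorem exists_hasSum_multiset_pow_div (s : Multiset ℂ) (hs : ∀ z ∈ s, ‖z‖ < 1) :
    ∃ S : ℂ, HasSum (fun n : ℕ => (s.map (· ^ n)).sum / n) S ∧
      Complex.exp S = ((s.map (1 - ·)).prod)⁻¹ := by
  induction s using Multiset.induction_on with
  | empty => exact ⟨0, by simp, by simp⟩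
  | cons a s ih =>
    obtain ⟨S, hS, hexp⟩ := ih fun z hz => hs z (Multiset.mem_cons_of_mem hz)
    have ha := hs a (Multiset.mem_cons_self a s)
    refine ⟨-Complex.log (1 - a) + S, ?_, ?_⟩
    · simpa [add_div] using (Complex.hasSum_taylorSeries_neg_log ha).add hS
    · have h1 : 1 - a ≠ 0 := fun h => by
        rw [← sub_eq_zero.1 h] at ha
        simp at ha
      rw [Complex.exp_add, Complex.exp_neg, Complex.exp_log h1, hexp]
      simp [mul_comm]

/-- If the column sums of the norms of `A` are less than one then `∑ tr (A ^ n) / n` is a logarithm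
of `det (1 - A)⁻¹`. -/
theorem Matrix.exists_hasSum_trace_pow_div {n : Type*} [Fintype n] [DecidableEq n]
    (A : Matrix n n ℂ) (hA : ∀ j, ∑ i, ‖A i j‖ < 1) :
    ∃ S : ℂ, HasSum (fun k : ℕ => (A ^ k).trace / k) S ∧ Complex.exp S = ((1 - A).det)⁻¹ := by
  have hroot : ∀ z ∈ A.charpoly.roots, ‖z‖ < 1 := by
    intro z hz
    by_contra! hz1
    refine det_ne_zero_of_sum_col_lt_diag (A := Matrix.scalar n z - A) (fun j => ?_) ?_
    · have h1 : ∑ i ∈ Finset.univ.erase j, ‖(Matrix.scalar n z - A) i j‖ =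
          ∑ i ∈ Finset.univ.erase j, ‖A i j‖ := Finset.sum_congr rfl fun i hi => by
        simp [Matrix.diagonal_apply_ne _ (Finset.ne_of_mem_erase hi)]
      have h2 := Finset.add_sum_erase Finset.univ (fun i => ‖A i j‖) (Finset.mem_univ j)
      have h3 := norm_sub_norm_le z (A j j)
      rw [h1]
      simp only [Matrix.sub_apply, Matrix.scalar_apply, Matrix.diagonal_apply_eq]
      linarith [hA j]
    · rw [← Matrix.eval_charpoly]
      exact Polynomial.isRoot_of_mem_roots hz
  obtain ⟨S, hS, hexp⟩ := exists_hasSum_multiset_pow_div _ hroot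
  refine ⟨S, by simpa only [Matrix.trace_pow_eq_sum_roots] using hS, ?_⟩
  have h1 := (IsAlgClosed.splits A.charpoly).eval_eq_prod_roots_of_monic A.charpoly_monic 1
  rw [Matrix.eval_charpoly, map_one] at h1
  rw [hexp, h1]

section TransferMatrix

variable {H : Type*} (r : H → H → Prop) (f : H → ℂ)

open Classical in
/-- The weight of a word that is cyclically compatible with `r`, and zero for other words. -/
noncomputable def cyclicWeight (P : List H) : ℂ :=
  if P ≠ [] ∧ Cycle.Chain r (P : Cycle H) then (P.map f).prod else 0

theorem norm_prod_map (P : List H) : ‖(P.map f).prod‖ = (P.map fun h => ‖f h‖).prod := by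
  induction P with
  | nil => simp
  | cons a P ih => simp [ih]

theorem norm_cyclicWeight_le (P : List H) :
    ‖cyclicWeight r f P‖ ≤ (P.map fun h => ‖f h‖).prod := by
  unfold cyclicWeight
  split_ifs
  · exact (norm_prod_map f P).le
  · rw [norm_zero, ← norm_prod_map]
    exact norm_nonneg _

theorem norm_prod_map_lt_one (hf : ∀ h, ‖f h‖ < 1) {P : List H} (hP : P ≠ []) :
    ‖(P.map f).prod‖ < 1 := by
  induction P with
  | nil => exact absurd rfl hP
  | cons a P ih =>
    rcases eq_or_ne P [] with rfl | h
    · simpa using hf a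
    · rw [List.map_cons, List.prod_cons, norm_mul]
      exact mul_lt_one_of_nonneg_of_lt_one_left (norm_nonneg _) (hf a) (ih h).le

variable [Fintype H]

theorem sum_prod_map_ofFn {R : Type*} [CommSemiring R] (f : H → R) (n : ℕ) :
    ∑ g : Fin n → H, ((List.ofFn g).map f).prod = (∑ h, f h) ^ n := by
  rw [Finset.sum_pow', Fintype.piFinset_univ]
  simp [List.map_ofFn, List.prod_ofFn]

theorem summable_prod_map_norm (hf : ∑ h, ‖f h‖ < 1) :
    Summable fun P : List H => (P.map fun h => ‖f h‖).prod := by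
  rw [← List.equivSigmaTuple.symm.summable_iff, summable_sigma_of_nonneg]
  · refine ⟨fun n => .of_finite, ?_⟩
    simp only [tsum_fintype, Function.comp_apply, List.equivSigmaTuple, Equiv.coe_fn_symm_mk,
      sum_prod_map_ofFn]
    exact summable_geometric_of_lt_one (Finset.sum_nonneg fun h _ => norm_nonneg _) hf
  · exact fun P => List.prod_nonneg (by simp)

variable [DecidableEq H]

open Classical in
/-- The transfer matrix of a relation with weights. -/
noncomputable def transferMatrix : Matrix H H ℂ := Matrix.of fun h k => if r h k then f h else 0

open Classical in
theorem transferMatrix_pow_apply (n : ℕ) (a b : H) : (transferMatrix r f ^ (n + 1)) a b =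
    ∑ g : Fin n → H, if List.IsChain r (a :: (List.ofFn g ++ [b])) then
      f a * ((List.ofFn g).map f).prod else 0 := by
  induction n generalizing a with
  | zero => simp [transferMatrix]
  | succ n ih =>
    rw [pow_succ', Matrix.mul_apply, ← (Fin.consEquiv fun _ : Fin (n + 1) => H).sum_comp,
      Fintype.sum_prod_type]
    refine Finset.sum_congr rfl fun c _ => ?_
    rw [ih, Finset.mul_sum]
    refine Finset.sum_congr rfl fun g _ => ?_
    by_cases h1 : r a c <;>
      simp [Fin.consEquiv, List.ofFn_succ, transferMatrix, h1]

theorem trace_transferMatrix_pow {n : ℕ} (hn : n ≠ 0) : (transferMatrix r f ^ n).trace =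
    ∑ g : Fin n → H, cyclicWeight r f (List.ofFn g) := by
  classical
  obtain ⟨n, rfl⟩ : ∃ m, n = m + 1 := Nat.exists_eq_succ_of_ne_zero hn
  rw [Matrix.trace, ← (Fin.consEquiv fun _ : Fin (n + 1) => H).sum_comp, Fintype.sum_prod_type]
  refine Finset.sum_congr rfl fun a _ => ?_
  rw [Matrix.diag_apply, transferMatrix_pow_apply]
  refine Finset.sum_congr rfl fun g _ => ?_
  simp [cyclicWeight, Fin.consEquiv, List.ofFn_succ]

/-- The sum of the weights of the cyclic words divided by their lengths is a logarithm of
`det (1 - W)⁻¹`, where `W` is the transfer matrix. -/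
theorem exists_hasSum_cyclicWeight_div (hf : ∑ h, ‖f h‖ < 1) :
    ∃ S : ℂ, HasSum (fun P : List H => cyclicWeight r f P / P.length) S ∧
      Complex.exp S = ((1 - transferMatrix r f).det)⁻¹ := by
  obtain ⟨S, hS, hexp⟩ := (transferMatrix r f).exists_hasSum_trace_pow_div fun j =>
    lt_of_le_of_lt (Finset.sum_le_sum fun i _ => show ‖transferMatrix r f i j‖ ≤ ‖f i‖ by
      simp only [transferMatrix, Matrix.of_apply]
      split_ifs <;> simp) hf
  have hsum : Summable fun P : List H => cyclicWeight r f P / P.length := by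
    refine .of_norm_bounded (summable_prod_map_norm f hf) fun P => ?_
    rw [norm_div, Complex.norm_natCast]
    rcases P.eq_nil_or_concat with rfl | ⟨Q, a, rfl⟩
    · simp
    · refine (div_le_self (norm_nonneg _) ?_).trans (norm_cyclicWeight_le r f _)
      simp
  refine ⟨S, ?_, hexp⟩
  rw [← List.equivSigmaTuple.symm.hasSum_iff]
  have hsum' := List.equivSigmaTuple.symm.summable_iff.2 hsum
  have h := hsum'.hasSum.sigma fun n => hasSum_fintype _
  have h2 : (fun n : ℕ => ∑ g : Fin n → H, ((fun P : List H => cyclicWeight r f P / P.length) ∘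
      List.equivSigmaTuple.symm) ⟨n, g⟩) = fun k : ℕ => (transferMatrix r f ^ k).trace / k := by
    ext n
    rcases eq_or_ne n 0 with rfl | hn
    · simp [List.equivSigmaTuple]
    · rw [trace_transferMatrix_pow r f hn, Finset.sum_div]
      refine Finset.sum_congr rfl fun g _ => ?_
      simp [List.equivSigmaTuple]
  rw [h2] at h
  rw [← h.unique hS]
  exact hsum'.hasSum

end TransferMatrix

namespace SerreGraph

variable {V H : Type*} (X : SerreGraph V H)

/-- `k` can follow `h` in a reduced path. -/
def NonBacktracking (h k : H) : Prop := X.target h = X.source k ∧ k ≠ X.inv h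

theorem isPrimitive_iff {P : List H} : X.IsPrimitive P ↔
    P ≠ [] ∧ Cycle.Chain X.NonBacktracking (P : Cycle H) ∧ P.rotationPeriod = P.length := by
  have hch : Cycle.Chain X.NonBacktracking (P : Cycle H) ↔
      Cycle.Chain (fun e f => X.target e = X.source f) (P : Cycle H) ∧ X.IsReduced P :=
    List.cycleChain_and_iff
  rw [hch]
  constructor
  · rintro ⟨⟨hne, hc⟩, hr, hp⟩
    refine ⟨hne, ⟨hc, hr⟩, ?_⟩
    obtain ⟨Q, k, hQ, hper, rfl⟩ := List.exists_eq_wordPow hne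
    rcases Nat.eq_zero_or_pos k with rfl | hk
    · simp [List.wordPow_succ, hper]
    · exact absurd rfl (hp Q (k + 1) ⟨hQ, (List.cycleChain_wordPow _ Q k).1 hc⟩ (by omega))
  · rintro ⟨hne, ⟨hc, hr⟩, hper⟩
    refine ⟨⟨hne, hc⟩, hr, fun Q c hQ hc2 hP => ?_⟩
    change P = Q.wordPow c at hP
    rw [hP, List.rotationPeriod_wordPow Q (by omega), List.length_wordPow] at hper
    have h1 := Nat.le_of_dvd (List.length_pos_iff.2 hQ.1) Q.rotationPeriod_dvd_length
    have h2 := List.length_pos_iff.2 hQ.1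
    nlinarith

/-- Closed reduced paths. -/
abbrev ReducedClosedPath : Type _ :=
  {P : List H // P ≠ [] ∧ Cycle.Chain X.NonBacktracking (P : Cycle H)}

/-- Every closed reduced path is uniquely a power of a primitive one. -/
noncomputable def primitivePowEquiv : {P : List H // X.IsPrimitive P} × ℕ ≃ X.ReducedClosedPath :=
  Equiv.ofBijective (fun p => ⟨p.1.1.wordPow (p.2 + 1), List.wordPow_ne_nil p.1.2.1.1 _,
    (List.cycleChain_wordPow _ _ _).2 (X.isPrimitive_iff.1 p.1.2).2.1⟩) <| by
  constructor
  · rintro ⟨⟨Q, hQ⟩, k⟩ ⟨⟨Q', hQ'⟩, k'⟩ h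
    simp only [Subtype.mk.injEq] at h
    rw [isPrimitive_iff] at hQ hQ'
    have hper := congrArg List.rotationPeriod h
    rw [List.rotationPeriod_wordPow _ k.succ_ne_zero, List.rotationPeriod_wordPow _ k'.succ_ne_zero,
      hQ.2.2, hQ'.2.2] at hper
    have hl := congrArg List.length h
    rw [List.length_wordPow, List.length_wordPow, hper] at hl
    have hk := Nat.eq_of_mul_eq_mul_right (List.length_pos_iff.2 hQ'.1) hl
    obtain rfl : k = k' := by omega
    obtain rfl := List.wordPow_left_injective k.succ_ne_zero h
    rfl
  · rintro ⟨P, hne, hc⟩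
    obtain ⟨Q, k, hQ, hper, rfl⟩ := List.exists_eq_wordPow hne
    exact ⟨(⟨Q, X.isPrimitive_iff.2 ⟨hQ, (List.cycleChain_wordPow _ Q k).1 hc, hper⟩⟩, k), rfl⟩

theorem IsPrimitive.rotate {P : List H} (hP : X.IsPrimitive P) (n : ℕ) :
    X.IsPrimitive (P.rotate n) := by
  rw [isPrimitive_iff] at hP ⊢
  refine ⟨by simpa using hP.1, ?_, ?_⟩
  · rw [(Cycle.coe_eq_coe.2 (List.IsRotated.forall P n) : (P.rotate n : Cycle H) = P)]
    exact hP.2.1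
  · rw [List.length_rotate, ← hP.2.2]
    refine Nat.dvd_antisymm ?_ ?_ <;> rw [← List.rotate_eq_self_iff_rotationPeriod_dvd]
    · rw [List.rotate_rotate, add_comm, ← List.rotate_rotate,
        List.rotate_eq_self_iff_rotationPeriod_dvd.2 dvd_rfl]
    · have h := List.rotate_eq_self_iff_rotationPeriod_dvd.2
        (dvd_refl (P.rotate n).rotationPeriod)
      rw [List.rotate_rotate, add_comm, ← List.rotate_rotate] at h
      exact List.rotate_eq_rotate.1 h

/-- The paths in the class of a prime are the distinct rotations of any of them. -/
noncomputable def rotationsEquiv (P : {P : List H // X.IsPrimitive P}) : Fin P.1.length ≃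
    {Q : {P : List H // X.IsPrimitive P} // (Quotient.mk X.primeSetoid Q) = ⟦P⟧} :=
  Equiv.ofBijective (fun i => ⟨⟨P.1.rotate i, P.2.rotate X i⟩,
    Quotient.sound (s := X.primeSetoid) (List.IsRotated.forall P.1 i)⟩) <| by
  constructor
  · intro i j h
    simp only [Subtype.mk.injEq] at h
    have hper := (X.isPrimitive_iff.1 P.2).2.2
    refine Fin.ext ((Function.iterate_eq_iterate_iff_of_lt_minimalPeriod
      (f := fun l : List H => l.rotate 1) (x := P.1) ?_ ?_).1 ?_)
    · exact i.2.trans_eq hper.symm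
    · exact j.2.trans_eq hper.symm
    · simpa only [List.iterate_rotate_one] using h
  · rintro ⟨Q, hQ⟩
    obtain ⟨n, hn⟩ : P.1 ~r Q.1 := (Quotient.exact (s := X.primeSetoid) hQ).symm
    refine ⟨⟨n % P.1.length, Nat.mod_lt _ (List.length_pos_iff.2 P.2.1.1)⟩, ?_⟩
    simp only [List.rotate_mod, hn]

/-- The weight of a prime for given weights of the oriented edges. -/
def primeWeight (f : H → ℂ) : X.PrimePath → ℂ :=
  Quotient.lift (fun P : {P : List H // X.IsPrimitive P} => (P.1.map f).prod)
    (fun _ _ h => (List.IsRotated.perm h |>.map f).prod_eq)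

/-- A sum over the primes as a sum over the primitive paths. -/
theorem hasSum_primePath {φ : X.PrimePath → ℂ} {S : ℂ}
    (h : HasSum (fun P : {P : List H // X.IsPrimitive P} =>
      (P.1.length : ℂ)⁻¹ * φ (Quotient.mk X.primeSetoid P)) S) : HasSum φ S := by
  rw [← (Equiv.sigmaFiberEquiv (Quotient.mk X.primeSetoid)).hasSum_iff] at h
  refine h.sigma fun p => ?_
  induction p using Quotient.inductionOn with
  | _ P =>
  rw [← (X.rotationsEquiv P).hasSum_iff]
  have hfin := hasSum_fintype fun _ : Fin P.1.length =>
    (P.1.length : ℂ)⁻¹ * φ (Quotient.mk X.primeSetoid P)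
  have hlen : (P.1.length : ℂ) ≠ 0 := by simpa using P.2.1.1
  rw [Finset.sum_const, Finset.card_univ, Fintype.card_fin, nsmul_eq_mul,
    mul_inv_cancel_left₀ hlen] at hfin
  refine hfin.congr_fun fun i => ?_
  change ((X.rotationsEquiv P i).1.1.length : ℂ)⁻¹ *
    φ (Quotient.mk X.primeSetoid (X.rotationsEquiv P i).1) = _
  rw [(X.rotationsEquiv P i).2, show (X.rotationsEquiv P i).1.1.length = P.1.length from
    List.length_rotate _ _]

/-- The Euler product over the primes. -/
theorem hasProd_primeWeight [Fintype H] [DecidableEq H] (f : H → ℂ) (hf : ∑ h, ‖f h‖ < 1) :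
    HasProd (fun p : X.PrimePath => (1 - X.primeWeight f p)⁻¹)
      ((1 - transferMatrix X.NonBacktracking f).det)⁻¹ := by
  classical
  obtain ⟨S, hS, hexp⟩ := exists_hasSum_cyclicWeight_div X.NonBacktracking f hf
  have hf1 : ∀ h, ‖f h‖ < 1 := fun h =>
    (Finset.single_le_sum (fun k _ => norm_nonneg (f k)) (Finset.mem_univ h)).trans_lt hf
  have hw : ∀ P : {P : List H // X.IsPrimitive P}, ‖(P.1.map f).prod‖ < 1 := fun P =>
    norm_prod_map_lt_one f hf1 P.2.1.1
  have h1 : HasSum (fun P : X.ReducedClosedPath => (P.1.map f).prod / P.1.length) S := by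
    have hsupp : Function.support
        (fun P : List H => cyclicWeight X.NonBacktracking f P / P.length) ⊆
        {P | P ≠ [] ∧ Cycle.Chain X.NonBacktracking (P : Cycle H)} := by
      intro P hP
      by_contra h
      have h0 : cyclicWeight X.NonBacktracking f P = 0 := if_neg h
      simp [h0] at hP
    refine HasSum.congr_fun ((hasSum_subtype_iff_of_support_subset hsupp).2 hS) fun P => ?_
    change _ = cyclicWeight X.NonBacktracking f P.1 / P.1.length
    rw [cyclicWeight, if_pos P.2]
  have h2 : HasSum (fun p : {P : List H // X.IsPrimitive P} × ℕ =>
      (p.1.1.length : ℂ)⁻¹ * ((p.1.1.map f).prod ^ (p.2 + 1) / (p.2 + 1))) S := by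
    rw [← X.primitivePowEquiv.hasSum_iff] at h1
    refine h1.congr_fun fun p => ?_
    change _ = ((p.1.1.wordPow (p.2 + 1)).map f).prod / ((p.1.1.wordPow (p.2 + 1)).length : ℂ)
    rw [List.prod_map_wordPow, List.length_wordPow, Nat.cast_mul, div_eq_mul_inv, div_eq_mul_inv,
      mul_inv]
    push_cast
    ring
  have h3 : HasSum (fun P : {P : List H // X.IsPrimitive P} =>
      (P.1.length : ℂ)⁻¹ * -Complex.log (1 - (P.1.map f).prod)) S :=
    HasSum.prod_fiberwise h2 fun P =>
      (Complex.hasSum_taylorSeries_neg_log' (hw P)).mul_left (P.1.length : ℂ)⁻¹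
  have h4 : HasSum (fun p : X.PrimePath => -Complex.log (1 - X.primeWeight f p)) S :=
    X.hasSum_primePath (φ := fun p => -Complex.log (1 - X.primeWeight f p)) h3
  have h5 : (fun p : X.PrimePath => (1 - X.primeWeight f p)⁻¹) =
      Complex.exp ∘ fun p : X.PrimePath => -Complex.log (1 - X.primeWeight f p) := by
    ext p
    induction p using Quotient.inductionOn with
    | _ P =>
    have hne : 1 - (P.1.map f).prod ≠ 0 := fun h => by
      have := hw P
      rw [← sub_eq_zero.1 h, norm_one] at this
      exact lt_irrefl _ this
    change _ = Complex.exp (-Complex.log (1 - (P.1.map f).prod))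
    rw [Complex.exp_neg, Complex.exp_log hne]
    rfl
  rw [← hexp, h5]
  exact h4.cexp

end SerreGraph

theorem DifferentiableAt.matrix_det_of_apply {n : Type*} [Fintype n] [DecidableEq n]
    {A : ℂ → Matrix n n ℂ} {z : ℂ} (hA : ∀ i j, DifferentiableAt ℂ (fun s => A s i j) z) :
    DifferentiableAt ℂ (fun s => (A s).det) z := by
  simp only [Matrix.det_apply']
  exact .fun_sum fun σ _ => (DifferentiableAt.fun_finsetProd fun i _ => hA _ _).const_mul _

theorem det_one_sub_transferMatrix_ne_zero {H : Type*} [Fintype H] [DecidableEq H]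
    (r : H → H → Prop) (f : H → ℂ) (hf : ∑ h, ‖f h‖ < 1) : (1 - transferMatrix r f).det ≠ 0 := by
  obtain ⟨S, -, hS⟩ := exists_hasSum_cyclicWeight_div r f hf
  intro h
  rw [h, inv_zero] at hS
  exact Complex.exp_ne_zero S hS

namespace SerreGraph

variable {V H : Type*} (X : SerreGraph V H)

section ScaledBass

variable [DecidableEq V] [Fintype H]

/-- Bass's vertex matrix with the row of `v₀` replaced by the column sums and with the other rows
multiplied by `t`, in terms of `u = (1 - y ^ 2) / t`. -/
noncomputable def scaledBassMatrix (v₀ : V) (t : ℂ) (u y : X.Edge → ℂ) : Matrix V V ℂ :=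
  Matrix.of fun a b => if a = v₀ then
      1 - ∑ h, if X.source h = b then y (X.edge h) / (1 + y (X.edge h)) else 0
    else (if a = b then t + ∑ h, if X.source h = a then
      y (X.edge h) ^ 2 / u (X.edge h) else 0 else 0) -
    ∑ h, if X.source h = a ∧ X.target h = b then y (X.edge h) / u (X.edge h) else 0

/-- Orientation reversal as a permutation of the oriented edges. -/
def invEquiv : Equiv.Perm H := ⟨X.inv, X.inv, X.inv_inv, X.inv_inv⟩

variable [Fintype V]

theorem sum_bassMatrix (y : X.Edge → ℂ) (hy : ∀ e, 1 - y e ^ 2 ≠ 0) (b : V) :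
    ∑ a, X.bassMatrix y a b =
      1 - ∑ h, if X.source h = b then y (X.edge h) / (1 + y (X.edge h)) else 0 := by
  simp only [bassMatrix, Matrix.of_apply, Finset.sum_sub_distrib]
  rw [Finset.sum_comm (s := Finset.univ (α := V)), Finset.sum_ite_eq' Finset.univ b,
    if_pos (Finset.mem_univ b)]
  have h1 : ∀ h : H, (∑ a, if X.source h = a ∧ X.target h = b then
      y (X.edge h) / (1 - y (X.edge h) ^ 2) else 0) =
      if X.target h = b then y (X.edge h) / (1 - y (X.edge h) ^ 2) else 0 := fun h => by
    simp [ite_and]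
  simp only [h1]
  have h6 : (∑ h, if X.target h = b then y (X.edge h) / (1 - y (X.edge h) ^ 2) else 0) =
      ∑ h, if X.source h = b then y (X.edge h) / (1 - y (X.edge h) ^ 2) else 0 := by
    rw [← Equiv.sum_comp X.invEquiv]
    refine Finset.sum_congr rfl fun h _ => ?_
    change (if X.target (X.inv h) = b then y (X.edge (X.inv h)) /
      (1 - y (X.edge (X.inv h)) ^ 2) else 0) = _
    rw [target_inv, edge_inv]
  rw [h6, add_sub_assoc, sub_eq_add_neg (1 : ℂ), ← Finset.sum_sub_distrib,
    ← Finset.sum_neg_distrib]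
  congr 1
  refine Finset.sum_congr rfl fun h _ => ?_
  have h2 := hy (X.edge h)
  have h3 : 1 - y (X.edge h) ^ 2 = (1 - y (X.edge h)) * (1 + y (X.edge h)) := by ring
  rw [h3] at h2
  have h4 := left_ne_zero_of_mul h2
  have h5 := right_ne_zero_of_mul h2
  split_ifs
  · rw [h3]
    field_simp
    ring
  · simp

theorem pow_mul_det_bassMatrix (v₀ : V) {t : ℂ} (ht : t ≠ 0) (u y : X.Edge → ℂ)
    (hu : ∀ e, u e ≠ 0) (huy : ∀ e, 1 - y e ^ 2 = t * u e) :
    t ^ (Fintype.card V - 1) * (X.bassMatrix y).det = (X.scaledBassMatrix v₀ t u y).det := by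
  have hy : ∀ e, 1 - y e ^ 2 ≠ 0 := fun e => huy e ▸ mul_ne_zero ht (hu e)
  have hrow := (X.bassMatrix y).det_updateRow_sum v₀ fun _ => 1
  rw [one_smul] at hrow
  have hprod : ∏ a : V, (if a = v₀ then 1 else t) = t ^ (Fintype.card V - 1) := by
    rw [← Finset.mul_prod_erase _ _ (Finset.mem_univ v₀), if_pos rfl, one_mul,
      Finset.prod_congr rfl fun a ha => if_neg (Finset.ne_of_mem_erase ha), Finset.prod_const,
      Finset.card_erase_of_mem (Finset.mem_univ v₀), Finset.card_univ]
  rw [← hrow, ← hprod, ← Matrix.det_mul_column]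
  congr 1
  ext a b
  rw [Matrix.of_apply, scaledBassMatrix, Matrix.of_apply]
  by_cases ha : a = v₀
  · subst ha
    rw [if_pos rfl, if_pos rfl, one_mul, Matrix.updateRow_self, ← X.sum_bassMatrix y hy b]
    simp only [one_smul]
    exact Finset.sum_apply b _ _
  · rw [if_neg ha, if_neg ha, Matrix.updateRow_ne ha]
    simp only [bassMatrix, Matrix.of_apply, huy, mul_sub, Finset.mul_sum, mul_ite, mul_zero,
      mul_add, mul_one]
    have hcancel : ∀ (w : ℂ) (e : X.Edge), t * (w / (t * u e)) = w / u e := fun w e => by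
      rw [← mul_div_assoc, mul_div_mul_left _ _ ht]
    simp only [hcancel]

theorem det_scaledBassMatrix_zero (v₀ : V) (u : X.Edge → ℂ) :
    (X.scaledBassMatrix v₀ 0 u 1).det =
      ((Fintype.card V : ℂ) - Fintype.card X.Edge) *
        (X.reducedLaplacian v₀ fun e => (u e)⁻¹).det := by
  set N := X.scaledBassMatrix v₀ 0 u 1 with hN
  have hcol := N.det_updateCol_sum v₀ fun _ => 1
  rw [one_smul] at hcol
  have hsum0 : ∀ a, a ≠ v₀ → ∑ b, N a b = 0 := by
    intro a ha
    simp only [hN, scaledBassMatrix, Matrix.of_apply, if_neg ha, Finset.sum_sub_distrib,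
      Finset.sum_ite_eq, Finset.mem_univ, if_true, zero_add]
    rw [Finset.sum_comm, ← Finset.sum_sub_distrib]
    refine Finset.sum_eq_zero fun h _ => ?_
    by_cases h1 : X.source h = a <;> simp [h1]
  have hsum : ∑ b, N v₀ b = (Fintype.card V : ℂ) - Fintype.card X.Edge := by
    simp only [hN, scaledBassMatrix, Matrix.of_apply, if_true, Finset.sum_sub_distrib]
    rw [Finset.sum_comm]
    simp [card_halfEdge X]
    ring
  rw [← hcol, Matrix.twoBlockTriangular_det _ (fun a => a = v₀)]
  · congr 1
    · have : Subsingleton {a // a = v₀} := ⟨fun a b => Subtype.ext (a.2.trans b.2.symm)⟩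
      have hdet := Matrix.det_eq_elem_of_subsingleton
        (Matrix.toSquareBlockProp (N.updateCol v₀ fun k => ∑ i, (1 : ℂ) • N k i) fun a => a = v₀)
        ⟨v₀, rfl⟩
      rw [Matrix.toSquareBlockProp_def, Matrix.of_apply, Matrix.updateCol_self] at hdet
      rw [Matrix.toSquareBlockProp_def, ← hsum]
      simp only [one_smul] at hdet ⊢
      convert hdet
    · congr 1
      ext ⟨a, ha⟩ ⟨b, hb⟩
      simp only [Matrix.toSquareBlockProp_def, Matrix.of_apply]
      rw [Matrix.updateCol_ne hb]
      simp [hN, scaledBassMatrix, reducedLaplacian, ha]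
  · intro a ha b hb
    subst hb
    rw [Matrix.updateCol_self]
    simpa using hsum0 a ha

end ScaledBass

theorem edgeMatrix_eq_transferMatrix [DecidableEq V] [DecidableEq H] (y : X.Edge → ℂ) :
    X.edgeMatrix y = transferMatrix X.NonBacktracking fun h => y (X.edge h) := by
  ext h k
  simp only [edgeMatrix, transferMatrix, NonBacktracking, Matrix.of_apply]
  congr

theorem cpow_pathLength (x : X.Edge → ℂ) {s : ℂ} (hs : s ≠ 0) (P : List H) :
    s ^ X.pathLength x P = (P.map fun h => s ^ x (X.edge h)).prod := by
  induction P with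
  | nil => simp [pathLength]
  | cons a P ih =>
    rw [List.map_cons, List.prod_cons, ← ih, ← Complex.cpow_add _ _ hs]
    simp [pathLength]

theorem eulerFactor_eq (x : X.Edge → ℂ) {s : ℂ} (hs : s ≠ 0) : X.eulerFactor x s =
    fun p => (1 - X.primeWeight (fun h => s ^ x (X.edge h)) p)⁻¹ := by
  ext p
  induction p using Quotient.inductionOn with
  | _ P => exact congrArg (fun w => (1 - w)⁻¹) (X.cpow_pathLength x hs P.1)

theorem exists_sum_norm_cpow_lt_one [Fintype H] (x : X.Edge → ℂ) (hx : ∀ e, 0 < (x e).re) :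
    ∃ r : ℝ, 0 < r ∧ ∀ s : ℂ, ‖s‖ < r → ∑ h, ‖s ^ x (X.edge h)‖ < 1 := by
  have hcont : ContinuousAt (fun s : ℂ => ∑ h, ‖s ^ x (X.edge h)‖) 0 := by
    refine tendsto_finsetSum _ fun h _ => ContinuousAt.norm ?_
    exact (Complex.continuousAt_cpow_zero_of_re_pos (hx (X.edge h))).comp
      (f := fun s : ℂ => (s, x (X.edge h))) (by fun_prop)
  have h0 : ∑ h, ‖(0 : ℂ) ^ x (X.edge h)‖ < 1 := by
    have : ∀ e, x e ≠ 0 := fun e he => by simpa [he] using hx e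
    simp [this]
  obtain ⟨r, hr, h⟩ := Metric.eventually_nhds_iff.1 (hcont.eventually_lt_const h0)
  exact ⟨r, hr, fun s hs => h (by simpa using hs)⟩

section Zeta

variable [DecidableEq V] [Fintype H] [DecidableEq H]

/-- The determinant that continues the reciprocal of the metric zeta function. -/
noncomputable def zetaDet (x : X.Edge → ℂ) (s : ℂ) : ℂ :=
  (1 - X.edgeMatrix fun e => s ^ x e).det

theorem isReciprocalMetricZeta_zetaDet (x : X.Edge → ℂ) (hx : ∀ e, 0 < (x e).re) :
    X.IsReciprocalMetricZeta x (X.zetaDet x) := by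
  constructor
  · refine DifferentiableOn.analyticOnNhd (fun s hs => ?_) Complex.isOpen_slitPlane
    refine (DifferentiableAt.matrix_det_of_apply fun h k => ?_).differentiableWithinAt
    simp only [Matrix.sub_apply, edgeMatrix, Matrix.of_apply]
    refine (differentiableAt_const _).sub ?_
    split_ifs
    · exact differentiableAt_id.cpow_const hs
    · exact differentiableAt_const _
  · obtain ⟨r, hr, h⟩ := X.exists_sum_norm_cpow_lt_one x hx
    refine ⟨r, hr, fun s hs hsr => ?_⟩
    have hprod := X.hasProd_primeWeight _ (h s hsr)
    rw [← X.eulerFactor_eq x (Complex.slitPlane_ne_zero hs),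
      ← X.edgeMatrix_eq_transferMatrix fun e => s ^ x e] at hprod
    refine ⟨hprod.multipliable, ?_⟩
    rw [metricZeta, hprod.tprod_eq]
    refine mul_inv_cancel₀ ?_
    rw [zetaDet, edgeMatrix_eq_transferMatrix]
    exact det_one_sub_transferMatrix_ne_zero _ _ (h s hsr)

end Zeta

theorem IsReciprocalMetricZeta.eqOn {x : X.Edge → ℂ} {F G : ℂ → ℂ}
    (hF : X.IsReciprocalMetricZeta x F) (hG : X.IsReciprocalMetricZeta x G) :
    Set.EqOn F G Complex.slitPlane := by
  obtain ⟨hFa, r, hr, hFr⟩ := hF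
  obtain ⟨hGa, r', hr', hGr⟩ := hG
  have hpos : 0 < min r r' := lt_min hr hr'
  have hz : ((min r r' / 2 : ℝ) : ℂ) ∈ Complex.slitPlane :=
    Complex.ofReal_mem_slitPlane.2 (half_pos hpos)
  refine hFa.eqOn_of_preconnected_of_eventuallyEq hGa
    (Complex.starConvex_one_slitPlane.isPathConnected
      Complex.one_mem_slitPlane).isConnected.isPreconnected hz ?_
  have hball : ∀ᶠ s : ℂ in 𝓝 ((min r r' / 2 : ℝ) : ℂ), ‖s‖ < min r r' := by
    refine (continuous_norm.tendsto _).eventually_lt_const ?_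
    rw [Complex.norm_real, Real.norm_of_nonneg (half_pos hpos).le]
    exact half_lt_self hpos
  filter_upwards [hball, Complex.isOpen_slitPlane.mem_nhds hz] with s hs hs'
  have h1 := (hFr s hs' (hs.trans_le (min_le_left _ _))).2
  have h2 := (hGr s hs' (hs.trans_le (min_le_right _ _))).2
  exact mul_right_cancel₀ (right_ne_zero_of_mul_eq_one h1) (h1.trans h2.symm)

/-- The difference quotient of `1 - s ^ (2 * z)` at `s = 1`. -/
noncomputable def edgeSlope (z s : ℂ) : ℂ := dslope (fun s : ℂ => 1 - (s ^ z) ^ 2) 1 s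

theorem mul_edgeSlope (z s : ℂ) : 1 - (s ^ z) ^ 2 = (s - 1) * edgeSlope z s := by
  have := sub_smul_dslope (fun s : ℂ => 1 - (s ^ z) ^ 2) 1 s
  simp only [Complex.one_cpow, smul_eq_mul] at this
  rw [edgeSlope, this]
  ring

theorem edgeSlope_one (z : ℂ) : edgeSlope z 1 = -2 * z := by
  rw [edgeSlope, dslope_same]
  have h : HasDerivAt (fun s : ℂ => s ^ z) z 1 := by
    simpa using (hasDerivAt_id (1 : ℂ)).cpow_const (c := z) Complex.one_mem_slitPlane
  have h2 := (h.pow 2).const_sub 1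
  simpa using h2.deriv

theorem differentiableAt_edgeSlope (z : ℂ) : DifferentiableAt ℂ (edgeSlope z) 1 := by
  have hn : Complex.slitPlane ∈ 𝓝 (1 : ℂ) :=
    Complex.isOpen_slitPlane.mem_nhds Complex.one_mem_slitPlane
  refine ((Complex.differentiableOn_dslope hn).2 fun s hs => ?_).differentiableAt hn
  exact (((differentiableAt_id.cpow_const hs).pow 2).const_sub 1).differentiableWithinAt

section Leading

variable [Fintype V] [DecidableEq V] [Fintype H]

/-- The quotient of the determinant by `(s - 1) ^ g`, extended to `s = 1`. -/
noncomputable def zetaDetQuotient (v₀ : V) (x : X.Edge → ℂ) (s : ℂ) : ℂ :=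
  (∏ e, edgeSlope (x e) s) *
    (X.scaledBassMatrix v₀ (s - 1) (fun e => edgeSlope (x e) s) fun e => s ^ x e).det

theorem differentiableAt_zetaDetQuotient (v₀ : V) (x : X.Edge → ℂ) (hx : ∀ e, x e ≠ 0) :
    DifferentiableAt ℂ (X.zetaDetQuotient v₀ x) 1 := by
  have hcpow : ∀ z : ℂ, DifferentiableAt ℂ (fun s : ℂ => s ^ z) 1 := fun z =>
    differentiableAt_id.cpow_const Complex.one_mem_slitPlane
  have hu : ∀ e, edgeSlope (x e) 1 ≠ 0 := fun e => by
    rw [edgeSlope_one]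
    exact mul_ne_zero (by norm_num) (hx e)
  refine (DifferentiableAt.fun_finsetProd fun e _ => differentiableAt_edgeSlope (x e)).mul
    (DifferentiableAt.matrix_det_of_apply fun a b => ?_)
  simp only [scaledBassMatrix, Matrix.of_apply]
  have hsum : ∀ (p : H → Prop) [DecidablePred p] (w : H → ℂ → ℂ),
      (∀ h, DifferentiableAt ℂ (w h) 1) →
      DifferentiableAt ℂ (fun s => ∑ h, if p h then w h s else 0) 1 := by
    intro p _ w hw
    refine .fun_sum fun h _ => ?_
    split_ifs
    · exact hw h
    · exact differentiableAt_const _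
  split_ifs
  · refine (hsum _ _ fun h => ?_).const_sub 1
    exact (hcpow _).div ((hcpow _).const_add 1) (by simp)
  · refine ((differentiableAt_id.sub_const 1).add (hsum _ _ fun h => ?_)).sub
      (hsum _ _ fun h => ?_)
    · exact ((hcpow _).pow 2).div (differentiableAt_edgeSlope _) (hu _)
    · exact (hcpow _).div (differentiableAt_edgeSlope _) (hu _)
  · refine (differentiableAt_const _).sub (hsum _ _ fun h => ?_)
    exact (hcpow _).div (differentiableAt_edgeSlope _) (hu _)

theorem zetaDet_eventuallyEq [DecidableEq H] (v₀ : V) (x : X.Edge → ℂ) (hx : ∀ e, 0 < (x e).re)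
    {g : ℕ} (hg : X.genus = g) :
    X.zetaDet x =ᶠ[𝓝 1] fun s => (s - 1) ^ g * X.zetaDetQuotient v₀ x s := by
  have hx0 : ∀ e, x e ≠ 0 := fun e he => by simpa [he] using hx e
  have hF : ContinuousAt (X.zetaDet x) 1 :=
    ((X.isReciprocalMetricZeta_zetaDet x hx).1 1 Complex.one_mem_slitPlane).continuousAt
  have hG : ContinuousAt (fun s => (s - 1) ^ g * X.zetaDetQuotient v₀ x s) 1 :=
    ((continuousAt_id.sub continuousAt_const).pow g).mul
      (X.differentiableAt_zetaDetQuotient v₀ x hx0).continuousAt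
  rw [← hF.eventuallyEq_nhds_iff_eventuallyEq_nhdsNE hG]
  have hu : ∀ᶠ s in 𝓝 (1 : ℂ), ∀ e, edgeSlope (x e) s ≠ 0 := by
    refine eventually_all.2 fun e => (differentiableAt_edgeSlope _).continuousAt.eventually_ne ?_
    rw [edgeSlope_one]
    exact mul_ne_zero (by norm_num) (hx0 e)
  filter_upwards [self_mem_nhdsWithin, nhdsWithin_le_nhds hu] with s hs hus
  have hs' : s - 1 ≠ 0 := sub_ne_zero.2 hs
  have hcard : Fintype.card X.Edge = g + (Fintype.card V - 1) := by
    have := Fintype.card_pos_iff.2 ⟨v₀⟩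
    rw [genus] at hg
    omega
  rw [zetaDet, det_one_sub_edgeMatrix, zetaDetQuotient,
    ← X.pow_mul_det_bassMatrix v₀ hs' _ _ hus fun e => mul_edgeSlope (x e) s]
  · simp only [mul_edgeSlope, Finset.prod_mul_distrib, Finset.prod_const, Finset.card_univ, hcard,
      pow_add]
    ring
  · intro e
    rw [mul_edgeSlope]
    exact mul_ne_zero hs' (hus e)

theorem zetaDetQuotient_one (v₀ : V) (x : X.Edge → ℂ) (hx : ∀ e, x e ≠ 0) {g : ℕ}
    (hg : X.genus = g) : X.zetaDetQuotient v₀ x 1 =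
      2 ^ g * (-1) ^ (g + 1) * ((g : ℂ) - 1) * MvPolynomial.aeval x X.jacobianPolynomial := by
  classical
  have h1 : (fun e : X.Edge => (1 : ℂ) ^ x e) = 1 := by
    ext e
    simp
  rw [zetaDetQuotient, sub_self, h1, det_scaledBassMatrix_zero, det_reducedLaplacian]
  simp only [edgeSlope_one]
  have hcard : (Fintype.card V : ℂ) - Fintype.card X.Edge = 1 - g := by
    have : (X.genus : ℂ) = g := by rw [hg]; simp
    rw [genus] at this
    push_cast at this
    linear_combination -this
  have hT : ∀ T : Finset X.Edge, X.IsSpanningTree T →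
      (∏ e, (-2 * x e)) * ∏ e ∈ T, (-2 * x e)⁻¹ = (-2) ^ g * ∏ e ∈ Tᶜ, x e := by
    intro T hT
    have hne : ∏ e ∈ T, (-2 * x e) ≠ 0 :=
      Finset.prod_ne_zero_iff.2 fun e _ => mul_ne_zero (by norm_num) (hx e)
    have hc : Tᶜ.card = g := by
      have := hT.2
      have h2 := T.card_le_univ
      rw [genus] at hg
      rw [Finset.card_compl]
      omega
    rw [← Finset.prod_compl_mul_prod T, Finset.prod_inv_distrib, mul_assoc, mul_inv_cancel₀ hne,
      mul_one, Finset.prod_mul_distrib, Finset.prod_const, hc]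
  have hsum : (∏ e, (-2 * x e)) * ∑ T : Finset X.Edge with X.IsSpanningTree T,
      ∏ e ∈ T, (-2 * x e)⁻¹ = (-2) ^ g * MvPolynomial.aeval x X.jacobianPolynomial := by
    rw [jacobianPolynomial, map_sum, Finset.mul_sum, Finset.mul_sum]
    refine Finset.sum_congr (by congr) fun T hT' => ?_
    rw [hT T (Finset.mem_filter.1 hT').2, map_prod]
    simp
  rw [hcard, mul_left_comm]
  have h2 : ((-2 : ℂ)) ^ g = 2 ^ g * (-1) ^ g := by rw [← mul_pow]; norm_num
  rw [h2] at hsum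
  rw [pow_succ]
  linear_combination (1 - (g : ℂ)) * hsum

end Leading

end SerreGraph

theorem proposition3p7 {V H : Type*} [Fintype V] [Fintype H] (X : SerreGraph V H)
    (hX : X.Connected) (g : ℕ) (hg : X.genus = (g : ℤ))
    (x : X.Edge → ℂ) (hx : ∀ e, 0 < (x e).re) :
    (∃ F : ℂ → ℂ, X.IsReciprocalMetricZeta x F) ∧
      ∀ F : ℂ → ℂ, X.IsReciprocalMetricZeta x F →
        (fun s : ℂ => F s - 2 ^ g * (-1) ^ (g + 1) * ((g : ℂ) - 1) *
            MvPolynomial.aeval x X.jacobianPolynomial * (s - 1) ^ g)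
          =O[𝓝 1] (fun s : ℂ => (s - 1) ^ (g + 1)) := by
  classical
  have hx0 : ∀ e, x e ≠ 0 := fun e he => by simpa [he] using hx e
  obtain ⟨v₀⟩ := hX.1
  refine ⟨⟨_, X.isReciprocalMetricZeta_zetaDet x hx⟩, fun F hF => ?_⟩
  have hFeq : F =ᶠ[𝓝 1] fun s => (s - 1) ^ g * X.zetaDetQuotient v₀ x s :=
    ((hF.eqOn X (X.isReciprocalMetricZeta_zetaDet x hx)).eventuallyEq_of_mem
      (Complex.isOpen_slitPlane.mem_nhds Complex.one_mem_slitPlane)).trans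
      (X.zetaDet_eventuallyEq v₀ x hx hg)
  have hO := (isBigO_refl (fun s : ℂ => (s - 1) ^ g) (𝓝 1)).mul
    (X.differentiableAt_zetaDetQuotient v₀ x hx0).isBigO_sub
  simp only [← pow_succ] at hO
  refine hO.congr' ?_ .rfl
  filter_upwards [hFeq] with s hs
  rw [hs, X.zetaDetQuotient_one v₀ x hx0 hg]
  ring
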